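/- Let $M,L\ge 1$, let $E_1,\dots,E_L$ be non-empty sets of directed edges (clusters) in $[M]\times[M]$, $R_i=|E_i|$, and let $\mathcal I=(\mathcal I_{e,e'})_{e,e'\in[M]\times[M]}$ be the Fisher information of the network at the pre-change parameter, with positive definite blocks $\mathcal I^{(i)}=(\mathcal I_{e,e'})_{e,e'\in E_i}$. Under the null hypothesis $H_0$ (no change) the score process is modelled by its Gaussian approximation: $(S_t^{e})_{t\in\mathbb R,\,e\in[M]\times[M]}$ is a centred Gaussian process with $\operatorname{Cov}(S_s^{e},S_t^{e'})=\tfrac12(|s|+|t|-|s-t|)\,\mathcal I_{e,e'}$ (that is, $\min(s,t)\,\mathcal I_{e,e'}$ for $s,t\ge 0$). For a window length $w$ and an update interval $\delta$, $0<\delta\le w$, put $$\Gamma^{(i)}_{t,w}=(wR_i)^{-1/2}\,\mathbf 1^\top(\mathcal I^{(i)})^{-1/2}\,(S^{e}_t-S^{e}_{t-w})_{e\in E_i},\qquad \Gamma_t=\max_{1\le i\le L}|\Gamma^{(i)}_{t,w}|,$$ so that each $\Gamma^{(i)}_{t,w}$ is standard normal and $\operatorname{Cov}(\Gamma^{(i)}_{t,w},\Gamma^{(j)}_{t+\epsilon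 w,w})=(1-\epsilon)^+\operatorname{Cov}(\Gamma^{(i)}_{t,w},\Gamma^{(j)}_{t,w})$ for $\epsilon\ge0$. For a threshold $b$ let $$T_b=\inf\{t\in\{\delta,2\delta,3\delta,\dots\}:\Gamma_t>b\}\in(0,\infty],\qquad f(b)=b\,e^{b^2/2}.$$ Let $w$, $\delta$ and the positive integer $m$ be allowed to depend on $b$, with $w/\delta\ll m\ll f(b)$, i.e. $(w/\delta)/m\to0$ and $m/f(b)\to0$ as $b\to\infty$. Fix $x\ge 0$, put $k=\lfloor x f(b)/m\rfloor$, and let $$W=\sum_{j=1}^{k}X_j,\qquad X_j=\mathbb I\Big\{\max_{(j-1)m<n\le jm}\Gamma_{n\delta}>b\Big\}.$$ Then $$\lim_{b\to\infty}\Big|\mathbb P\big(T_b>x f(b)\,\delta\big)-e^{-\mathbb E W}\Big|=0 .$$ -/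

import Mathlib

open MeasureTheory ProbabilityTheory Filter Topology

namespace HawkesScan

noncomputable section

/-- An edge `(p, q)` of the network on `M` nodes (the influence of node `p` on node `q`). -/
abbrev Edge (M : ℕ) : Type := Fin M × Fin M

variable {Ω : Type*} [MeasurableSpace Ω] {M L : ℕ}

/-- The score process under the null hypothesis, in the Gaussian process approximation: the
`M²`-dimensional process `S` is a centred (two-sided) Gaussian process with stationary independent
increments and covariance `I` per unit of time, where `I` is the Fisher information at the
pre-change parameter. For `0 ≤ s, t` the factor `(|s| + |t| - |s - t|) / 2` is `min s t`; hence
increments of `S` over two time intervals have covariance `I` times the length of the overlap of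
the intervals. Negative times serve the windows `[t - w, t]` with `t < w`. -/
structure IsNullScore (S : ℝ → Edge M → Ω → ℝ) (I : Matrix (Edge M) (Edge M) ℝ)
    (P : Measure Ω) : Prop where
  gaussian : IsGaussianProcess (fun (a : ℝ × Edge M) (ω : Ω) => S a.1 a.2 ω) P
  mean_zero : ∀ t e, ∫ ω, S t e ω ∂P = 0
  covariance : ∀ s t e e',
    cov[S s e, S t e'; P] = (|s| + |t| - |s - t|) / 2 * I e e'

/-- The Fisher information of the edges of one cluster. -/
def clusterInfo (I : Matrix (Edge M) (Edge M) ℝ) (E : Finset (Edge M)) : Matrix E E ℝ :=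
  I.submatrix Subtype.val Subtype.val

/-- `A ^ (-1/2)` for a positive definite matrix `A`, by the functional calculus. -/
def invSqrt {n : Type*} [Fintype n] [DecidableEq n] (A : Matrix n n ℝ) : Matrix n n ℝ :=
  cfc (fun x : ℝ => (√x)⁻¹) A

/-- `S_{t,w} = (S_t^{(p,q)} - S_{t-w}^{(p,q)})`, `(p,q)` in the cluster `E`. -/
def windowScore (S : ℝ → Edge M → Ω → ℝ) (E : Finset (Edge M)) (w t : ℝ) (ω : Ω) : E → ℝ :=
  fun e => S t e ω - S (t - w) e ω

/-- The statistic of the cluster `E`,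
`Γ_{t,w} = (w R)^{-1/2} 1ᵀ I_E^{-1/2} S_{t,w}` with `R` the number of edges of `E`. -/
def clusterStat (S : ℝ → Edge M → Ω → ℝ) (I : Matrix (Edge M) (Edge M) ℝ)
    (E : Finset (Edge M)) (w t : ℝ) (ω : Ω) : ℝ :=
  (√(w * (E.card : ℝ)))⁻¹ *
    ((fun _ => 1) ⬝ᵥ Matrix.mulVec (invSqrt (clusterInfo I E)) (windowScore S E w t ω))

/-- The scan statistic `Γ_t = max_{1 ≤ i ≤ L} |Γ_{t,w}^{(i)}|`. -/
def scanStat (S : ℝ → Edge M → Ω → ℝ) (I : Matrix (Edge M) (Edge M) ℝ)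
    (E : Fin L → Finset (Edge M)) (w t : ℝ) (ω : Ω) : ℝ :=
  ⨆ i : Fin L, |clusterStat S I (E i) w t ω|

/-- `T_b = inf {t : Γ_t > b}`, where `t` runs through the update times `δ, 2δ, 3δ, …`;
the value is `⊤` if there is no alarm. -/
def stopTime (S : ℝ → Edge M → Ω → ℝ) (I : Matrix (Edge M) (Edge M) ℝ)
    (E : Fin L → Finset (Edge M)) (w δ b : ℝ) (ω : Ω) : EReal :=
  sInf {T : EReal | ∃ n : ℕ, 1 ≤ n ∧ b < scanStat S I E w (n * δ) ω ∧ T = ((n * δ : ℝ) : EReal)}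

/-- The event that `Γ_{nδ} > b` for some `n` of the `j`-th block `(j-1)m < n ≤ jm`, `j ≥ 1`. -/
def blockEvent (S : ℝ → Edge M → Ω → ℝ) (I : Matrix (Edge M) (Edge M) ℝ)
    (E : Fin L → Finset (Edge M)) (w δ b : ℝ) (m j : ℕ) : Set Ω :=
  {ω | ∃ n ∈ Finset.Ioc ((j - 1) * m) (j * m), b < scanStat S I E w (n * δ) ω}

/-- `W = X_1 + ⋯ + X_k`, with `X_j` the indicator of the `j`-th block event. -/
def blockCount (S : ℝ → Edge M → Ω → ℝ) (I : Matrix (Edge M) (Edge M) ℝ)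
    (E : Fin L → Finset (Edge M)) (w δ b : ℝ) (m k : ℕ) (ω : Ω) : ℝ :=
  ∑ j ∈ Finset.Icc 1 k, (blockEvent S I E w δ b m j).indicator (fun _ => (1 : ℝ)) ω

/-- `f(b) = b e^{b²/2}`. -/
def runScale (b : ℝ) : ℝ := b * Real.exp (b ^ 2 / 2)

end

end HawkesScan

/-!
By the Gaussian tail bound `P(|Z| > b) ≤ 2 / f(b)`, every update time is an exceedance with
probability `O(1 / f(b))`. The statistics at two update times are independent as soon as their
windows do not overlap, so the blocks of `m` update times become independent once the first
`q = ⌊w / δ⌋` times of each are removed. Removing them costs `O(k q / f(b)) = O((w / δ) / m)`, since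
there are `k = O(f(b) / m)` blocks; the last, incomplete block costs `O(m / f(b))`; and for
independent events of probabilities `pⱼ` the estimate `1 - p = e^{-p} + O(p²)` gives
`∏ (1 - pⱼ) = e^{-∑ pⱼ} + O(∑ pⱼ²)`, where `∑ pⱼ² = O(k (m / f(b))²) = O(m / f(b))`.
-/

namespace HawkesScan

open scoped Matrix NNReal

lemma abs_add_add_abs_sub {R : Type*} [CommRing R] [LinearOrder R] [IsStrictOrderedRing R]
    (x y : R) : |x + y| + |x - y| = 2 * max |x| |y| := by
  rcases max_cases |x| |y| with h | h <;>
    rcases abs_cases x with hx | hx <;> rcases abs_cases y with hy | hy <;>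
    rcases abs_cases (x + y) with hs | hs <;> rcases abs_cases (x - y) with hd | hd <;> linarith

lemma norm_prod_sub_prod_le {ι R : Type*} [NormedCommRing R] [NormOneClass R] (s : Finset ι)
    {u v : ι → R} (hu : ∀ i ∈ s, ‖u i‖ ≤ 1) (hv : ∀ i ∈ s, ‖v i‖ ≤ 1) :
    ‖∏ i ∈ s, u i - ∏ i ∈ s, v i‖ ≤ ∑ i ∈ s, ‖u i - v i‖ := by
  classical
  induction s using Finset.induction_on with
  | empty => simp
  | insert a s ha ih =>
    rw [Finset.forall_mem_insert] at hu hv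
    have hv_prod : ‖∏ i ∈ s, v i‖ ≤ 1 :=
      (Finset.norm_prod_le s v).trans (Finset.prod_le_one (fun _ _ => norm_nonneg _) hv.2)
    rw [Finset.prod_insert ha, Finset.prod_insert ha, Finset.sum_insert ha]
    calc ‖u a * ∏ i ∈ s, u i - v a * ∏ i ∈ s, v i‖
        = ‖(u a - v a) * ∏ i ∈ s, v i + u a * (∏ i ∈ s, u i - ∏ i ∈ s, v i)‖ := by ring_nf
      _ ≤ ‖u a - v a‖ * ‖∏ i ∈ s, v i‖ + ‖u a‖ * ‖∏ i ∈ s, u i - ∏ i ∈ s, v i‖ :=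
          (norm_add_le _ _).trans (add_le_add (norm_mul_le _ _) (norm_mul_le _ _))
      _ ≤ ‖u a - v a‖ * 1 + 1 * ∑ i ∈ s, ‖u i - v i‖ := by
          gcongr
          · exact hu.1
          · exact ih hu.2 hv.2
      _ = ‖u a - v a‖ + ∑ i ∈ s, ‖u i - v i‖ := by rw [mul_one, one_mul]

lemma abs_prod_one_sub_sub_exp_neg_sum_le {ι : Type*} (s : Finset ι) {p : ι → ℝ}
    (hp : ∀ i ∈ s, p i ∈ Set.Icc 0 1) :
    |∏ i ∈ s, (1 - p i) - Real.exp (-∑ i ∈ s, p i)| ≤ ∑ i ∈ s, p i ^ 2 := by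
  rw [← Finset.sum_neg_distrib, Real.exp_sum, ← Real.norm_eq_abs]
  refine (norm_prod_sub_prod_le s (fun i hi => ?_) fun i hi => ?_).trans
    (Finset.sum_le_sum fun i hi => ?_)
  · exact abs_le.2 ⟨by linarith [(hp i hi).2], by linarith [(hp i hi).1]⟩
  · rw [Real.norm_of_nonneg (Real.exp_nonneg _), Real.exp_le_one_iff]
    exact neg_nonpos.2 (hp i hi).1
  · have h := Real.abs_exp_sub_one_sub_id_le (x := -p i)
      (by rw [abs_neg, abs_of_nonneg (hp i hi).1]; exact (hp i hi).2)
    rw [neg_sq] at h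
    rw [Real.norm_eq_abs, abs_sub_comm]
    convert! h using 2
    ring

lemma abs_exp_neg_sub_exp_neg_le {a c : ℝ} (ha : 0 ≤ a) (hc : 0 ≤ c) :
    |Real.exp (-a) - Real.exp (-c)| ≤ |a - c| := by
  wlog hac : a ≤ c generalizing a c
  · rw [abs_sub_comm, abs_sub_comm a]
    exact this hc ha (le_of_not_ge hac)
  have h_factor : Real.exp (-c) = Real.exp (-a) * Real.exp (-(c - a)) := by
    rw [← Real.exp_add]
    ring_nf
  have h_le_one : Real.exp (-a) ≤ 1 := Real.exp_le_one_iff.2 (neg_nonpos.2 ha)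
  rw [abs_of_nonneg (sub_nonneg.2 (Real.exp_le_exp.2 (neg_le_neg hac))),
    abs_of_nonpos (sub_nonpos.2 hac), h_factor]
  nlinarith [Real.add_one_le_exp (-(c - a)), Real.exp_pos (-a)]

lemma hasDerivAt_gaussianPDFReal (μ : ℝ) (v : ℝ≥0) (x : ℝ) :
    HasDerivAt (gaussianPDFReal μ v) (-((x - μ) / v * gaussianPDFReal μ v x)) x := by
  have h_exponent : HasDerivAt (fun x : ℝ => -(x - μ) ^ 2 / (2 * v)) (-((x - μ) / v)) x := by
    convert! (((hasDerivAt_id x).sub_const μ).pow 2).neg.div_const (2 * (v : ℝ)) using 1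
    simp only [id, Nat.cast_ofNat, Nat.add_one_sub_one, pow_one, mul_one]
    rw [neg_div, mul_div_mul_left _ _ two_ne_zero]
  rw [gaussianPDFReal_def]
  convert! h_exponent.exp.const_mul (√(2 * Real.pi * v))⁻¹ using 1
  ring

lemma tendsto_gaussianPDFReal_atTop (μ : ℝ) (v : ℝ≥0) :
    Tendsto (gaussianPDFReal μ v) atTop (𝓝 0) := by
  rcases eq_or_ne v 0 with rfl | hv
  · rw [gaussianPDFReal_zero_var]
    exact tendsto_const_nhds
  have h_sq : Tendsto (fun x : ℝ => (x - μ) ^ 2 / (2 * v)) atTop atTop :=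
    ((tendsto_pow_atTop two_ne_zero).comp (tendsto_atTop_add_const_right _ (-μ) tendsto_id)
      ).atTop_div_const (by positivity)
  have h_exp := (Real.tendsto_exp_neg_atTop_nhds_zero.comp h_sq).const_mul
    (√(2 * Real.pi * v))⁻¹
  rw [mul_zero] at h_exp
  refine h_exp.congr fun x => ?_
  rw [gaussianPDFReal, Function.comp_apply, neg_div]

-- Mills' bound: on `(b, ∞)` the density `φ` is at most `(x - μ) / (b - μ) * φ x`, a derivative.
lemma measureReal_gaussianReal_Ioi_le {μ b : ℝ} {v : ℝ≥0} (hv : v ≠ 0) (hb : μ < b) :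
    (gaussianReal μ v).real (Set.Ioi b) ≤ v / (b - μ) * gaussianPDFReal μ v b := by
  have hderiv : ∀ x ∈ Set.Ici b, HasDerivAt (fun x => -(v / (b - μ) * gaussianPDFReal μ v x))
      ((x - μ) / (b - μ) * gaussianPDFReal μ v x) x := fun x _ => by
    convert! ((hasDerivAt_gaussianPDFReal μ v x).const_mul (v / (b - μ))).neg using 1
    field_simp
  have hlim : Tendsto (fun x => -(v / (b - μ) * gaussianPDFReal μ v x)) atTop (𝓝 0) := by
    simpa only [mul_zero, neg_zero] using
      ((tendsto_gaussianPDFReal_atTop μ v).const_mul (v / (b - μ))).neg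
  have hpos : ∀ x ∈ Set.Ioi b, 0 ≤ (x - μ) / (b - μ) * gaussianPDFReal μ v x := fun x hx =>
    mul_nonneg (div_nonneg (by linarith [Set.mem_Ioi.1 hx]) (by linarith))
      (gaussianPDFReal_nonneg μ v x)
  calc (gaussianReal μ v).real (Set.Ioi b)
      = ∫ x in Set.Ioi b, gaussianPDFReal μ v x := by
        rw [Measure.real, gaussianReal_apply_eq_integral μ hv, ENNReal.toReal_ofReal]
        exact integral_nonneg fun x => gaussianPDFReal_nonneg μ v x
    _ ≤ ∫ x in Set.Ioi b, (x - μ) / (b - μ) * gaussianPDFReal μ v x := by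
        refine setIntegral_mono_on (integrable_gaussianPDFReal μ v).integrableOn
          (integrableOn_Ioi_deriv_of_nonneg' hderiv hpos hlim) measurableSet_Ioi fun x hx => ?_
        refine le_mul_of_one_le_left (gaussianPDFReal_nonneg μ v x) ?_
        rw [one_le_div (sub_pos.2 hb)]
        exact sub_le_sub_right (Set.mem_Ioi.1 hx).le μ
    _ = v / (b - μ) * gaussianPDFReal μ v b := by
        rw [integral_Ioi_of_hasDerivAt_of_nonneg' hderiv hpos hlim, zero_sub, neg_neg]

lemma measureReal_gaussianReal_lt_abs_le {b : ℝ} {v : ℝ≥0} (hv : v ≠ 0) (hb : 0 < b) :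
    (gaussianReal 0 v).real {x | b < |x|} ≤ 2 * (v / b * gaussianPDFReal 0 v b) := by
  have h_union : {x : ℝ | b < |x|} = Set.Ioi b ∪ (fun x => -x) ⁻¹' Set.Ioi b := by
    ext x
    simp only [Set.mem_ofPred_eq, Set.mem_union, Set.mem_Ioi, Set.mem_preimage, lt_abs]
  have h_symm : (gaussianReal 0 v).real ((fun x => -x) ⁻¹' Set.Ioi b)
      = (gaussianReal 0 v).real (Set.Ioi b) := by
    rw [← map_measureReal_apply measurable_neg measurableSet_Ioi, gaussianReal_map_neg, neg_zero]
  have h_tail := measureReal_gaussianReal_Ioi_le hv hb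
  rw [sub_zero] at h_tail
  rw [h_union, two_mul]
  exact (measureReal_union_le _ _).trans (add_le_add h_tail (h_symm.trans_le h_tail))

lemma measureReal_stdGaussian_lt_abs_le {b : ℝ} (hb : 0 < b) :
    (gaussianReal 0 1).real {x | b < |x|} ≤ 2 / runScale b := by
  have h_const : (√(2 * Real.pi))⁻¹ ≤ 1 :=
    inv_le_one_of_one_le₀ (Real.one_le_sqrt.2 (by linarith [Real.pi_gt_three]))
  calc (gaussianReal 0 1).real {x | b < |x|}
      ≤ 2 * ((√(2 * Real.pi))⁻¹ * (runScale b)⁻¹) := by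
        refine (measureReal_gaussianReal_lt_abs_le one_ne_zero hb).trans_eq ?_
        rw [gaussianPDFReal, runScale, mul_inv, ← Real.exp_neg]
        simp only [NNReal.coe_one, sub_zero, mul_one, neg_div, one_div]
        ring
    _ ≤ 2 * (1 * (runScale b)⁻¹) := by
        have : 0 ≤ runScale b := mul_nonneg hb.le (Real.exp_nonneg _)
        gcongr
    _ = 2 / runScale b := by rw [one_mul, div_eq_mul_inv]

section IndependentEvents

variable {Ω ι : Type*} [MeasurableSpace Ω] {P : Measure Ω}

lemma iIndepSet_preimage_of_iIndepFun {β : ι → Type*} [∀ i, MeasurableSpace (β i)]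
    {X : ∀ i, Ω → β i} (hX : iIndepFun X P) {B : ∀ i, Set (β i)} (hB : ∀ i, MeasurableSet (B i)) :
    iIndepSet (fun i => X i ⁻¹' B i) P := by
  refine (iIndepSet_iff_iIndep _ _).2 (iIndep_of_iIndep_of_le hX.iIndep fun i => ?_)
  exact MeasurableSpace.generateFrom_le fun _ ht => ht ▸ ⟨B i, hB i, rfl⟩

lemma abs_measureReal_sub_le_of_subset [IsFiniteMeasure P] {A B : Set Ω} (hAB : A ⊆ B) :
    |P.real A - P.real B| ≤ P.real (B \ A) := by
  rw [abs_sub_comm, abs_of_nonneg (sub_nonneg.2 (measureReal_mono hAB))]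
  exact le_measureReal_sdiff

lemma measureReal_biUnion_le_card_mul {A : ι → Set Ω} {p : ℝ} (s : Finset ι)
    (hA : ∀ i ∈ s, P.real (A i) ≤ p) : P.real (⋃ i ∈ s, A i) ≤ s.card * p :=
  (measureReal_biUnion_finset_le s A).trans <| by
    simpa only [nsmul_eq_mul] using Finset.sum_le_card_nsmul s _ p hA

lemma abs_measureReal_compl_biUnion_sub_exp_le [IsProbabilityMeasure P] {C : ι → Set Ω}
    (hC : iIndepSet C P) (hCm : ∀ i, NullMeasurableSet (C i) P) (s : Finset ι) :
    |P.real (⋃ i ∈ s, C i)ᶜ - Real.exp (-∑ i ∈ s, P.real (C i))| ≤ ∑ i ∈ s, P.real (C i) ^ 2 := by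
  have h_prod : P.real (⋃ i ∈ s, C i)ᶜ = ∏ i ∈ s, (1 - P.real (C i)) := by
    have h_indep : P (⋂ i ∈ s, (C i)ᶜ) = ∏ i ∈ s, P (C i)ᶜ :=
      ((iIndepSet_iff_iIndep _ _).1 hC).meas_biInter fun i _ =>
        (MeasurableSpace.measurableSet_generateFrom (Set.mem_singleton (C i))).compl
    rw [Set.compl_iUnion₂, Measure.real, h_indep, ENNReal.toReal_prod]
    exact Finset.prod_congr rfl fun i _ => probReal_compl_eq_one_sub₀ (hCm i)
  rw [h_prod]
  exact abs_prod_one_sub_sub_exp_neg_sum_le s fun i _ => ⟨measureReal_nonneg, measureReal_le_one⟩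

lemma abs_measureReal_compl_biUnion_sub_exp_le_of_subset [IsProbabilityMeasure P]
    {B C : ι → Set Ω} (hC : iIndepSet C P) (hCm : ∀ i, NullMeasurableSet (C i) P)
    (hCB : ∀ i, C i ⊆ B i) (s : Finset ι) :
    |P.real (⋃ i ∈ s, B i)ᶜ - Real.exp (-∑ i ∈ s, P.real (B i))|
      ≤ ∑ i ∈ s, P.real (C i) ^ 2 + 2 * ∑ i ∈ s, P.real (B i \ C i) := by
  have h_union : |P.real (⋃ i ∈ s, B i)ᶜ - P.real (⋃ i ∈ s, C i)ᶜ|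
      ≤ ∑ i ∈ s, P.real (B i \ C i) := by
    have h_sdiff : (⋃ i ∈ s, C i)ᶜ \ (⋃ i ∈ s, B i)ᶜ ⊆ ⋃ i ∈ s, B i \ C i := by
      rintro ω ⟨hωC, hωB⟩
      obtain ⟨i, hi, hω⟩ := Set.mem_iUnion₂.1 (not_not.1 hωB)
      exact Set.mem_biUnion hi ⟨hω, fun h => hωC (Set.mem_biUnion hi h)⟩
    have h_subset : (⋃ i ∈ s, B i)ᶜ ⊆ (⋃ i ∈ s, C i)ᶜ :=
      Set.compl_subset_compl.2 (Set.iUnion₂_mono fun i _ => hCB i)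
    exact (abs_measureReal_sub_le_of_subset h_subset).trans
      ((measureReal_mono h_sdiff (measure_ne_top P _)).trans (measureReal_biUnion_finset_le _ _))
  have h_exp : |Real.exp (-∑ i ∈ s, P.real (C i)) - Real.exp (-∑ i ∈ s, P.real (B i))|
      ≤ ∑ i ∈ s, P.real (B i \ C i) := by
    refine (abs_exp_neg_sub_exp_neg_le (Finset.sum_nonneg fun _ _ => measureReal_nonneg)
      (Finset.sum_nonneg fun _ _ => measureReal_nonneg)).trans ?_
    rw [← Finset.sum_sub_distrib]
    exact (Finset.abs_sum_le_sum_abs _ _).trans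
      (Finset.sum_le_sum fun i _ => abs_measureReal_sub_le_of_subset (hCB i))
  have h_indep := abs_measureReal_compl_biUnion_sub_exp_le hC hCm s
  rw [abs_le] at *
  constructor <;> linarith

end IndependentEvents

section Blocks

variable {Ω : Type*}

/-- The union of the events `A n` over the `j`-th block `(j - 1) m < n ≤ j m` of indices, without
the first `q` indices of the block. For `q = 0` this is the union over the whole block, for large
`q` it is independent of the other trimmed blocks. Blocks are counted from `j = 1`. -/
def trimmedBlock (A : ℕ → Set Ω) (m q j : ℕ) : Set Ω :=
  ⋃ n ∈ Finset.Ioc ((j - 1) * m + q) (j * m), A n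

variable {A : ℕ → Set Ω} {m q j : ℕ}

lemma trimmedBlock_subset : trimmedBlock A m q j ⊆ trimmedBlock A m 0 j :=
  Set.biUnion_subset_biUnion_left (Finset.Ioc_subset_Ioc_left (by omega))

lemma trimmedBlock_zero_sdiff_subset :
    trimmedBlock A m 0 j \ trimmedBlock A m q j
      ⊆ ⋃ n ∈ Finset.Ioc ((j - 1) * m) ((j - 1) * m + q), A n := by
  rintro ω ⟨hω, hω_trimmed⟩
  obtain ⟨n, hn, hωn⟩ := Set.mem_iUnion₂.1 hω
  rw [Finset.mem_Ioc] at hn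
  have hnq : n ≤ (j - 1) * m + q := not_lt.1 fun h =>
    hω_trimmed (Set.mem_biUnion (Finset.mem_Ioc.2 ⟨h, hn.2⟩) hωn)
  exact Set.mem_biUnion (Finset.mem_Ioc.2 ⟨hn.1, hnq⟩) hωn

lemma biUnion_trimmedBlock_zero (A : ℕ → Set Ω) (m k : ℕ) :
    ⋃ j ∈ Finset.Icc 1 k, trimmedBlock A m 0 j = ⋃ n ∈ Finset.Ioc 0 (k * m), A n := by
  induction k with
  | zero => simp
  | succ k ih =>
    have h_split : Finset.Ioc 0 ((k + 1) * m)
        = Finset.Ioc 0 (k * m) ∪ Finset.Ioc (k * m) ((k + 1) * m) :=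
      (Finset.Ioc_union_Ioc_eq_Ioc (Nat.zero_le _) (Nat.mul_le_mul_right m k.le_succ)).symm
    rw [← Finset.insert_Icc_right_eq_Icc_add_one (Nat.le_add_left 1 k), Finset.set_biUnion_insert,
      ih, h_split, Finset.set_biUnion_union, Set.union_comm]
    rfl

variable [MeasurableSpace Ω] {P : Measure Ω}

lemma nullMeasurableSet_trimmedBlock (hA : ∀ n, NullMeasurableSet (A n) P) :
    NullMeasurableSet (trimmedBlock A m q j) P :=
  Finset.nullMeasurableSet_biUnion _ fun n _ => hA n

variable {p : ℝ}

lemma measureReal_trimmedBlock_le (hA : ∀ n, P.real (A n) ≤ p) :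
    P.real (trimmedBlock A m q j) ≤ m * p := by
  have hp : 0 ≤ p := measureReal_nonneg.trans (hA 0)
  refine (measureReal_biUnion_le_card_mul _ fun n _ => hA n).trans ?_
  gcongr
  rw [Nat.card_Ioc, Nat.sub_mul, one_mul]
  omega

lemma measureReal_trimmedBlock_zero_sdiff_le [IsFiniteMeasure P] (hA : ∀ n, P.real (A n) ≤ p) :
    P.real (trimmedBlock A m 0 j \ trimmedBlock A m q j) ≤ q * p := by
  refine (measureReal_mono trimmedBlock_zero_sdiff_subset (measure_ne_top P _)).trans ?_
  refine (measureReal_biUnion_le_card_mul _ fun n _ => hA n).trans_eq ?_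
  rw [Nat.card_Ioc, Nat.add_sub_cancel_left]

lemma abs_measureReal_compl_biUnion_Ioc_sub_le [IsFiniteMeasure P] (hA : ∀ n, P.real (A n) ≤ p)
    {l N : ℕ} (hlN : l ≤ N) :
    |P.real (⋃ n ∈ Finset.Ioc 0 N, A n)ᶜ - P.real (⋃ n ∈ Finset.Ioc 0 l, A n)ᶜ|
      ≤ (N - l) * p := by
  have h_split : ⋃ n ∈ Finset.Ioc 0 N, A n
      = (⋃ n ∈ Finset.Ioc 0 l, A n) ∪ ⋃ n ∈ Finset.Ioc l N, A n := by
    rw [← Finset.set_biUnion_union, Finset.Ioc_union_Ioc_eq_Ioc l.zero_le hlN]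
  have h_subset : ⋃ n ∈ Finset.Ioc 0 l, A n ⊆ ⋃ n ∈ Finset.Ioc 0 N, A n :=
    h_split ▸ Set.subset_union_left
  have h_sdiff : (⋃ n ∈ Finset.Ioc 0 l, A n)ᶜ \ (⋃ n ∈ Finset.Ioc 0 N, A n)ᶜ
      ⊆ ⋃ n ∈ Finset.Ioc l N, A n := by
    rw [h_split]
    exact fun ω hω => (not_not.1 hω.2).resolve_left hω.1
  refine (abs_measureReal_sub_le_of_subset (Set.compl_subset_compl.2 h_subset)).trans
    ((measureReal_mono h_sdiff (measure_ne_top P _)).trans ?_)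
  refine (measureReal_biUnion_le_card_mul _ fun n _ => hA n).trans_eq ?_
  rw [Nat.card_Ioc, Nat.cast_sub hlN]

lemma abs_measureReal_compl_biUnion_Ioc_sub_exp_le [IsProbabilityMeasure P]
    (hAm : ∀ n, NullMeasurableSet (A n) P) (hA : ∀ n, P.real (A n) ≤ p) (hm : 0 < m)
    (h_indep : iIndepSet (trimmedBlock A m q) P) (N : ℕ) :
    |P.real (⋃ n ∈ Finset.Ioc 0 N, A n)ᶜ
        - Real.exp (-∑ j ∈ Finset.Icc 1 (N / m), P.real (trimmedBlock A m 0 j))|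
      ≤ m * p + N / m * ((m * p) ^ 2 + 2 * (q * p)) := by
  have hp : 0 ≤ p := measureReal_nonneg.trans (hA 0)
  have h_last : |P.real (⋃ n ∈ Finset.Ioc 0 N, A n)ᶜ
      - P.real (⋃ n ∈ Finset.Ioc 0 (N / m * m), A n)ᶜ| ≤ m * p := by
    refine (abs_measureReal_compl_biUnion_Ioc_sub_le hA (Nat.div_mul_le_self N m)).trans ?_
    gcongr
    rw [sub_le_iff_le_add']
    exact_mod_cast (Nat.lt_div_mul_add hm).le
  have h_sq : ∑ j ∈ Finset.Icc 1 (N / m), P.real (trimmedBlock A m q j) ^ 2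
      ≤ (N / m : ℕ) * (m * p) ^ 2 := by
    refine (Finset.sum_le_card_nsmul _ _ _ fun j _ => pow_le_pow_left₀ measureReal_nonneg
      (measureReal_trimmedBlock_le hA) 2).trans_eq ?_
    rw [Nat.card_Icc, Nat.add_sub_cancel, nsmul_eq_mul]
  have h_gaps : ∑ j ∈ Finset.Icc 1 (N / m),
      P.real (trimmedBlock A m 0 j \ trimmedBlock A m q j) ≤ (N / m : ℕ) * (q * p) := by
    refine (Finset.sum_le_card_nsmul _ _ _ fun j _ =>
      measureReal_trimmedBlock_zero_sdiff_le hA).trans_eq ?_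
    rw [Nat.card_Icc, Nat.add_sub_cancel, nsmul_eq_mul]
  have h_blocks := abs_measureReal_compl_biUnion_sub_exp_le_of_subset h_indep
    (fun _ => nullMeasurableSet_trimmedBlock hAm) (fun _ => trimmedBlock_subset)
    (Finset.Icc 1 (N / m))
  rw [biUnion_trimmedBlock_zero] at h_blocks
  calc _ ≤ m * p + (N / m : ℕ) * ((m * p) ^ 2 + 2 * (q * p)) := by
        refine (abs_sub_le _ _ _).trans ((add_le_add h_last h_blocks).trans ?_)
        linarith
    _ ≤ m * p + N / m * ((m * p) ^ 2 + 2 * (q * p)) := by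
        gcongr
        exact Nat.cast_div_le

end Blocks

section StatWeight

lemma transpose_invSqrt {n : Type*} [Fintype n] [DecidableEq n] (A : Matrix n n ℝ) :
    (invSqrt A)ᵀ = invSqrt A := by
  have h : (invSqrt A).IsHermitian :=
    cfc_predicate (p := IsSelfAdjoint) (fun x : ℝ => (√x)⁻¹) A
  rwa [Matrix.IsHermitian, Matrix.conjTranspose_eq_transpose_of_trivial] at h

lemma invSqrt_mul_mul_invSqrt {n : Type*} [Fintype n] [DecidableEq n] {A : Matrix n n ℝ}
    (hA : A.PosDef) : invSqrt A * A * invSqrt A = 1 := by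
  have hsa : IsSelfAdjoint A := hA.isHermitian
  have hpos : ∀ x ∈ spectrum ℝ A, 0 < x := by
    rw [hA.isHermitian.spectrum_real_eq_range_eigenvalues]
    exact Set.forall_mem_range.2 hA.eigenvalues_pos
  have hcont : ContinuousOn (fun x : ℝ => (√x)⁻¹) (spectrum ℝ A) :=
    Real.continuous_sqrt.continuousOn.inv₀ fun x hx => (Real.sqrt_pos.2 (hpos x hx)).ne'
  calc invSqrt A * A * invSqrt A
      = cfc (fun x : ℝ => (√x)⁻¹) A * cfc (fun x : ℝ => x) A * cfc (fun x : ℝ => (√x)⁻¹) A := by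
        rw [cfc_id' ℝ A, invSqrt]
    _ = cfc (fun x : ℝ => (√x)⁻¹ * x * (√x)⁻¹) A := by
        rw [← cfc_mul _ (fun x => x) A hcont continuousOn_id,
          ← cfc_mul (fun x : ℝ => (√x)⁻¹ * x) _ A (hcont.mul continuousOn_id) hcont]
    _ = cfc (fun _ : ℝ => (1 : ℝ)) A := by
        refine cfc_congr fun x hx => ?_
        have hsqrt : 0 < √x := Real.sqrt_pos.2 (hpos x hx)
        nth_rewrite 2 [← Real.mul_self_sqrt (hpos x hx).le]
        field_simp
    _ = 1 := cfc_const_one ℝ A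

variable {M : ℕ}

/-- The coefficients `(w R)^{-1/2} I_E^{-1/2} 1` of the window scores of the cluster `E` in its
statistic `Γ_{t,w}`. -/
noncomputable def statWeight (I : Matrix (Edge M) (Edge M) ℝ) (E : Finset (Edge M)) (w : ℝ) :
    E → ℝ :=
  (√(w * E.card))⁻¹ • (invSqrt (clusterInfo I E) *ᵥ fun _ => 1)

lemma clusterStat_eq_dotProduct {Ω : Type*} (S : ℝ → Edge M → Ω → ℝ)
    (I : Matrix (Edge M) (Edge M) ℝ) (E : Finset (Edge M)) (w t : ℝ) (ω : Ω) :
    clusterStat S I E w t ω = statWeight I E w ⬝ᵥ windowScore S E w t ω := by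
  rw [clusterStat, statWeight, Matrix.dotProduct_mulVec, ← Matrix.mulVec_transpose,
    transpose_invSqrt, smul_dotProduct, smul_eq_mul]

lemma mul_statWeight_dotProduct_clusterInfo_mulVec {I : Matrix (Edge M) (Edge M) ℝ}
    {E : Finset (Edge M)} (hE : E.Nonempty) (hI : (clusterInfo I E).PosDef) {w : ℝ} (hw : 0 < w) :
    w * (statWeight I E w ⬝ᵥ clusterInfo I E *ᵥ statWeight I E w) = 1 := by
  set A := clusterInfo I E
  have hR : 0 < (E.card : ℝ) := Nat.cast_pos.2 hE.card_pos
  have h_unscaled : invSqrt A *ᵥ (fun _ => 1) ⬝ᵥ A *ᵥ invSqrt A *ᵥ (fun _ => 1) = E.card := by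
    nth_rewrite 1 [← transpose_invSqrt A]
    rw [Matrix.mulVec_transpose, ← Matrix.dotProduct_mulVec, Matrix.mulVec_mulVec,
      Matrix.mulVec_mulVec, invSqrt_mul_mul_invSqrt hI, Matrix.one_mulVec]
    simp [dotProduct]
  rw [statWeight, Matrix.mulVec_smul, smul_dotProduct, dotProduct_smul, h_unscaled, smul_eq_mul,
    smul_eq_mul]
  field_simp
  rw [Real.sq_sqrt (mul_pos hw hR).le]

end StatWeight

section ScoreProcess

variable {Ω : Type*} {M L : ℕ} {I : Matrix (Edge M) (Edge M) ℝ} {S : ℝ → Edge M → Ω → ℝ}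

lemma lt_scanStat_iff {E : Fin L → Finset (Edge M)} {w t b : ℝ} {ω : Ω} (hb : 0 < b) :
    b < scanStat S I E w t ω ↔ ∃ i, b < |clusterStat S I (E i) w t ω| := by
  refine ⟨fun h => ?_, fun ⟨i, hi⟩ => hi.trans_le <|
    le_ciSup (f := fun i => |clusterStat S I (E i) w t ω|) (Set.finite_range _).bddAbove i⟩
  rcases isEmpty_or_nonempty (Fin L) with hL | hL
  · rw [scanStat, Real.iSup_of_isEmpty] at h
    exact absurd h hb.not_gt
  · exact exists_lt_of_lt_ciSup h

variable [MeasurableSpace Ω] {P : Measure Ω}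

lemma IsNullScore.memLp_two (hS : IsNullScore S I P) (t : ℝ) (e : Edge M) : MemLp (S t e) 2 P :=
  (hS.gaussian.hasGaussianLaw_eval (t, e)).memLp_two

lemma IsNullScore.memLp_two_windowScore (hS : IsNullScore S I P) {E : Finset (Edge M)} (w t : ℝ)
    (e : E) : MemLp (fun ω => windowScore S E w t ω e) 2 P :=
  (hS.memLp_two t e).sub (hS.memLp_two (t - w) e)

-- `(|w| - |s - t|)⁺` is the length of the overlap of the windows that end at `s` and at `t`.
lemma IsNullScore.covariance_windowScore [IsFiniteMeasure P] (hS : IsNullScore S I P)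
    {E E' : Finset (Edge M)} (w s t : ℝ) (e : E) (e' : E') :
    cov[fun ω => windowScore S E w s ω e, fun ω => windowScore S E' w t ω e'; P]
      = max (|w| - |s - t|) 0 * I e e' := by
  have h_overlap : max (|w| - |s - t|) 0 = (|s - t + w| + |s - t - w|) / 2 - |s - t| := by
    rw [abs_add_add_abs_sub, mul_div_cancel_left₀ _ two_ne_zero, max_comm, ← max_sub_sub_right,
      sub_self]
  have h_cov := covariance_fun_sub_fun_sub (hS.memLp_two s e) (hS.memLp_two (s - w) e)
    (hS.memLp_two t e') (hS.memLp_two (t - w) e')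
  simp only [hS.covariance, ← sub_add, sub_right_comm s w t, sub_add_cancel] at h_cov
  rw [h_overlap]
  exact h_cov.trans (by ring)

lemma IsNullScore.covariance_clusterStat [IsFiniteMeasure P] (hS : IsNullScore S I P)
    (E E' : Finset (Edge M)) (w s t : ℝ) :
    cov[clusterStat S I E w s, clusterStat S I E' w t; P] = max (|w| - |s - t|) 0 *
      (statWeight I E w ⬝ᵥ I.submatrix Subtype.val Subtype.val *ᵥ statWeight I E' w) := by
  have h_sum (E : Finset (Edge M)) (s : ℝ) : clusterStat S I E w s
      = fun ω => ∑ e, statWeight I E w e * windowScore S E w s ω e :=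
    funext fun ω => clusterStat_eq_dotProduct S I E w s ω
  have h_memLp (E : Finset (Edge M)) (s : ℝ) (e : E) :
      MemLp (fun ω => statWeight I E w e * windowScore S E w s ω e) 2 P :=
    (hS.memLp_two_windowScore w s e).const_mul _
  rw [h_sum E, h_sum E', covariance_fun_sum_fun_sum (h_memLp E s) (h_memLp E' t)]
  simp only [covariance_const_mul_left, covariance_const_mul_right, hS.covariance_windowScore,
    dotProduct, Matrix.mulVec, Finset.mul_sum, Matrix.submatrix_apply]
  refine Finset.sum_congr rfl fun e _ => Finset.sum_congr rfl fun e' _ => ?_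
  ring

lemma IsNullScore.isGaussianProcess_clusterStat (hS : IsNullScore S I P) (w : ℝ) :
    IsGaussianProcess
      (fun (a : Finset (Edge M) × ℝ) ω => clusterStat S I a.1 w a.2 ω) P := by
  classical
  refine hS.gaussian.of_isGaussianProcess fun ⟨E, t⟩ => ?_
  let J : Finset (ℝ × Edge M) := {t, t - w} ×ˢ Finset.univ
  have ht (e : Edge M) : (t, e) ∈ J := by simp [J]
  have htw (e : Edge M) : (t - w, e) ∈ J := by simp [J]
  refine ⟨J, ∑ e : E, statWeight I E w e • (ContinuousLinearMap.proj ⟨(t, e), ht e⟩ -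
    ContinuousLinearMap.proj ⟨(t - w, e), htw e⟩), fun ω => ?_⟩
  rw [clusterStat_eq_dotProduct]
  simp [dotProduct, windowScore]

lemma IsNullScore.aemeasurable_clusterStat (hS : IsNullScore S I P) (E : Finset (Edge M))
    (w t : ℝ) : AEMeasurable (clusterStat S I E w t) P :=
  (hS.isGaussianProcess_clusterStat w).aemeasurable (E, t)

lemma IsNullScore.integral_clusterStat [IsFiniteMeasure P] (hS : IsNullScore S I P)
    (E : Finset (Edge M)) (w t : ℝ) : ∫ ω, clusterStat S I E w t ω ∂P = 0 := by
  have h_window (e : E) : ∫ ω, windowScore S E w t ω e ∂P = 0 := by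
    have h_int (t : ℝ) : Integrable (S t e) P := (hS.memLp_two t e).integrable one_le_two
    simp only [windowScore]
    rw [integral_sub (h_int t) (h_int (t - w)), hS.mean_zero, hS.mean_zero, sub_zero]
  simp only [clusterStat_eq_dotProduct, dotProduct]
  rw [integral_finsetSum _ fun e _ =>
    ((hS.memLp_two_windowScore w t e).integrable one_le_two).const_mul _]
  exact Finset.sum_eq_zero fun e _ => by rw [integral_const_mul, h_window, mul_zero]

section ExceedanceProbability

variable [IsFiniteMeasure P] {w : ℝ}

lemma IsNullScore.map_clusterStat (hS : IsNullScore S I P) {E : Finset (Edge M)}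
    (hE : E.Nonempty) (hI : (clusterInfo I E).PosDef) (hw : 0 < w) (t : ℝ) :
    P.map (clusterStat S I E w t) = gaussianReal 0 1 := by
  have h_gauss : HasGaussianLaw (clusterStat S I E w t) P :=
    (hS.isGaussianProcess_clusterStat w).hasGaussianLaw_eval (E, t)
  have h_var : Var[clusterStat S I E w t; P] = 1 := by
    rw [← covariance_self (hS.aemeasurable_clusterStat E w t), hS.covariance_clusterStat,
      sub_self, abs_zero, sub_zero, abs_of_pos hw, max_eq_left hw.le]
    exact mul_statWeight_dotProduct_clusterInfo_mulVec hE hI hw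
  rw [h_gauss.map_eq_gaussianReal, hS.integral_clusterStat, h_var, Real.toNNReal_one]

variable {b : ℝ}

lemma IsNullScore.measureReal_lt_abs_clusterStat_le (hS : IsNullScore S I P)
    {E : Finset (Edge M)} (hE : E.Nonempty) (hI : (clusterInfo I E).PosDef) (hw : 0 < w) (t : ℝ)
    (hb : 0 < b) : P.real {ω | b < |clusterStat S I E w t ω|} ≤ 2 / runScale b := by
  refine le_of_eq_of_le ?_ (measureReal_stdGaussian_lt_abs_le hb)
  rw [← hS.map_clusterStat hE hI hw t,
    map_measureReal_apply_of_aemeasurable (hS.aemeasurable_clusterStat E w t)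
      (measurableSet_lt measurable_const continuous_abs.measurable)]
  rfl

lemma IsNullScore.measureReal_lt_scanStat_le (hS : IsNullScore S I P)
    {E : Fin L → Finset (Edge M)} (hE : ∀ i, (E i).Nonempty)
    (hI : ∀ i, (clusterInfo I (E i)).PosDef) (hw : 0 < w) (t : ℝ) (hb : 0 < b) :
    P.real {ω | b < scanStat S I E w t ω} ≤ 2 * L / runScale b := by
  have h_union : {ω | b < scanStat S I E w t ω}
      = ⋃ i ∈ Finset.univ, {ω | b < |clusterStat S I (E i) w t ω|} := by
    ext ω
    simp [lt_scanStat_iff hb]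
  rw [h_union]
  refine (measureReal_biUnion_le_card_mul _ fun i _ =>
    hS.measureReal_lt_abs_clusterStat_le (hE i) (hI i) hw t hb).trans_eq ?_
  rw [Finset.card_univ, Fintype.card_fin]
  ring

end ExceedanceProbability

lemma IsNullScore.aemeasurable_scanStat (hS : IsNullScore S I P) (E : Fin L → Finset (Edge M))
    (w t : ℝ) : AEMeasurable (scanStat S I E w t) P :=
  AEMeasurable.iSup fun i => continuous_abs.measurable.comp_aemeasurable
    (hS.aemeasurable_clusterStat (E i) w t)

lemma IsNullScore.iIndepFun_clusterStat [IsFiniteMeasure P] (hS : IsNullScore S I P)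
    {κ : Type*} {α : κ → Type*} {w : ℝ} (E : ∀ k, α k → Finset (Edge M)) (τ : ∀ k, α k → ℝ)
    (hτ : ∀ k l, k ≠ l → ∀ a c, |w| ≤ |τ k a - τ l c|) :
    iIndepFun (fun k ω a => clusterStat S I (E k a) w (τ k a) ω) P := by
  have h_gauss := (hS.isGaussianProcess_clusterStat w).comp_right
    fun a : (k : κ) × α k => (E a.1 a.2, τ a.1 a.2)
  refine h_gauss.iIndepFun_of_covariance_eq_zero
    (fun k a => hS.aemeasurable_clusterStat (E k a) w (τ k a)) fun k l hkl a c => ?_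
  rw [hS.covariance_clusterStat, max_eq_right (sub_nonpos.2 (hτ k l hkl a c)), zero_mul]

lemma IsNullScore.iIndepSet_biUnion_lt_scanStat [IsFiniteMeasure P] (hS : IsNullScore S I P)
    {κ α : Type*} (E : Fin L → Finset (Edge M)) {w : ℝ} (b : ℝ) {τ : α → ℝ} {s : κ → Finset α}
    (hs : ∀ k l, k ≠ l → ∀ a ∈ s k, ∀ c ∈ s l, |w| ≤ |τ a - τ c|) :
    iIndepSet (fun k => ⋃ a ∈ s k, {ω | b < scanStat S I E w (τ a) ω}) P := by
  have h_indep := hS.iIndepFun_clusterStat (α := fun k => Fin L × s k)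
    (fun _ a => E a.1) (fun _ a => τ a.2)
    fun k l hkl a c => hs k l hkl a.2 a.2.2 c.2 c.2.2
  have h_meas (k : κ) :
      MeasurableSet (⋃ a : s k, {y : Fin L × s k → ℝ | b < ⨆ i, |y (i, a)|}) :=
    MeasurableSet.iUnion fun a => measurableSet_lt measurable_const <|
      Measurable.iSup fun i => continuous_abs.measurable.comp (measurable_pi_apply (i, a))
  convert! iIndepSet_preimage_of_iIndepFun h_indep h_meas using 2 with k
  ext ω
  simp [scanStat]

end ScoreProcess

section StoppingTime

variable {Ω : Type*} {M L : ℕ} {I : Matrix (Edge M) (Edge M) ℝ} {S : ℝ → Edge M → Ω → ℝ}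

/-- The event `Γ_{nδ} > b` of an alarm at the `n`-th update time. -/
def exceedance (S : ℝ → Edge M → Ω → ℝ) (I : Matrix (Edge M) (Edge M) ℝ)
    (E : Fin L → Finset (Edge M)) (w δ b : ℝ) (n : ℕ) : Set Ω :=
  {ω | b < scanStat S I E w (n * δ) ω}

lemma blockEvent_eq_trimmedBlock (E : Fin L → Finset (Edge M)) (w δ b : ℝ) (m j : ℕ) :
    blockEvent S I E w δ b m j = trimmedBlock (exceedance S I E w δ b) m 0 j := by
  ext ω
  simp [blockEvent, trimmedBlock, exceedance]

lemma setOf_lt_stopTime_eq (E : Fin L → Finset (Edge M)) (w b : ℝ) {δ : ℝ} (hδ : 0 < δ) (y : ℝ) :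
    {ω | ((y * δ : ℝ) : EReal) < stopTime S I E w δ b ω}
      = (⋃ n ∈ Finset.Ioc 0 ⌊y⌋₊, exceedance S I E w δ b n)ᶜ := by
  ext ω
  simp only [exceedance, Set.mem_ofPred_eq, Set.mem_compl_iff, Set.mem_iUnion, Finset.mem_Ioc,
    exists_prop, not_exists, not_and]
  constructor
  · intro h_lt n hn hb
    have h_stop : stopTime S I E w δ b ω ≤ ((n * δ : ℝ) : EReal) := sInf_le ⟨n, hn.1, hb, rfl⟩
    have h_lt_n : y < n :=
      lt_of_mul_lt_mul_right (EReal.coe_lt_coe_iff.1 (h_lt.trans_le h_stop)) hδ.le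
    exact h_lt_n.not_ge ((Nat.le_floor_iff' hn.1.ne').1 hn.2)
  · intro h_none
    have h_lt : y * δ < ((⌊y⌋₊ + 1 : ℕ) : ℝ) * δ := by
      push_cast
      gcongr
      exact Nat.lt_floor_add_one y
    refine (EReal.coe_lt_coe_iff.2 h_lt).trans_le (le_sInf ?_)
    rintro _ ⟨n, hn, hb, rfl⟩
    have h_floor : ⌊y⌋₊ + 1 ≤ n := not_lt.1 fun h => h_none n ⟨hn, Nat.lt_succ_iff.1 h⟩ hb
    exact EReal.coe_le_coe_iff.2 (by gcongr)

variable [MeasurableSpace Ω] {P : Measure Ω}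

lemma IsNullScore.nullMeasurableSet_exceedance (hS : IsNullScore S I P)
    (E : Fin L → Finset (Edge M)) (w δ b : ℝ) (n : ℕ) :
    NullMeasurableSet (exceedance S I E w δ b n) P :=
  nullMeasurableSet_lt aemeasurable_const (hS.aemeasurable_scanStat E w _)

lemma IsNullScore.iIndepSet_trimmedBlock_exceedance [IsFiniteMeasure P]
    (hS : IsNullScore S I P) (E : Fin L → Finset (Edge M)) {w δ : ℝ} (b : ℝ) (m : ℕ) {q : ℕ}
    (hδ : 0 ≤ δ) (hq : |w| ≤ (q + 1) * δ) :
    iIndepSet (trimmedBlock (exceedance S I E w δ b) m q) P := by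
  refine hS.iIndepSet_biUnion_lt_scanStat E b (τ := fun n : ℕ => n * δ)
    (s := fun j => Finset.Ioc ((j - 1) * m + q) (j * m)) fun i j hij a ha c hc => ?_
  wlog h_lt : i < j generalizing i j a c
  · rw [abs_sub_comm]
    exact this j i hij.symm c hc a ha (hij.lt_or_gt.resolve_left h_lt)
  have h_blocks : i * m ≤ (j - 1) * m := Nat.mul_le_mul_right m (Nat.le_sub_one_of_lt h_lt)
  have h_gap : (a : ℝ) + (q + 1) ≤ c := by
    rw [Finset.mem_Ioc] at ha hc
    exact_mod_cast (by omega : a + (q + 1) ≤ c)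
  calc |w| ≤ (q + 1) * δ := hq
    _ ≤ (c - a) * δ := by gcongr; linarith
    _ = -(a * δ - c * δ) := by ring
    _ ≤ |a * δ - c * δ| := neg_le_abs _

lemma IsNullScore.integral_blockCount [IsFiniteMeasure P] (hS : IsNullScore S I P)
    (E : Fin L → Finset (Edge M)) (w δ b : ℝ) (m k : ℕ) :
    ∫ ω, blockCount S I E w δ b m k ω ∂P
      = ∑ j ∈ Finset.Icc 1 k, P.real (blockEvent S I E w δ b m j) := by
  have h_meas (j : ℕ) : NullMeasurableSet (blockEvent S I E w δ b m j) P := by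
    rw [blockEvent_eq_trimmedBlock]
    exact nullMeasurableSet_trimmedBlock (hS.nullMeasurableSet_exceedance E w δ b)
  simp only [blockCount]
  rw [integral_finsetSum _ fun j _ => (integrable_const (1 : ℝ)).indicator₀ (h_meas j)]
  refine Finset.sum_congr rfl fun j _ => ?_
  rw [integral_indicator₀ (h_meas j), setIntegral_const, smul_eq_mul, mul_one]

lemma IsNullScore.abs_measureReal_lt_stopTime_sub_exp_le [IsProbabilityMeasure P]
    (hS : IsNullScore S I P) {E : Fin L → Finset (Edge M)} (hE : ∀ i, (E i).Nonempty)
    (hI : ∀ i, (clusterInfo I (E i)).PosDef) {w δ b : ℝ} (hw : 0 < w) (hδ : 0 < δ) (hb : 0 < b)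
    {m : ℕ} (hm : 0 < m) {x : ℝ} (hx : 0 ≤ x) :
    |P.real {ω | ((x * runScale b * δ : ℝ) : EReal) < stopTime S I E w δ b ω}
        - Real.exp (-∫ ω, blockCount S I E w δ b m ⌊x * runScale b / (m : ℝ)⌋₊ ω ∂P)|
      ≤ 2 * L * (1 + 2 * L * x) * (m / runScale b) + 4 * L * x * (w / δ / m) := by
  have hf : 0 < runScale b := mul_pos hb (Real.exp_pos _)
  have h_floor : (⌊x * runScale b⌋₊ : ℝ) ≤ x * runScale b := Nat.floor_le (mul_nonneg hx hf.le)
  have hq_le : (⌊w / δ⌋₊ : ℝ) ≤ w / δ := Nat.floor_le (div_pos hw hδ).le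
  have hq : |w| ≤ (⌊w / δ⌋₊ + 1) * δ := by
    rw [abs_of_pos hw, ← div_le_iff₀ hδ]
    exact (Nat.lt_floor_add_one _).le
  rw [setOf_lt_stopTime_eq E w b hδ, hS.integral_blockCount, Nat.floor_div_natCast]
  simp only [blockEvent_eq_trimmedBlock]
  refine (abs_measureReal_compl_biUnion_Ioc_sub_exp_le (hS.nullMeasurableSet_exceedance E w δ b)
    (fun n => hS.measureReal_lt_scanStat_le hE hI hw (n * δ) hb) hm
    (hS.iIndepSet_trimmedBlock_exceedance E b m hδ.le hq) _).trans ?_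
  calc _ ≤ m * (2 * L / runScale b) + x * runScale b / m *
        ((m * (2 * L / runScale b)) ^ 2 + 2 * (w / δ * (2 * L / runScale b))) := by gcongr
    _ = 2 * L * (1 + 2 * L * x) * (m / runScale b) + 4 * L * x * (w / δ / m) := by
        field_simp
        ring

end StoppingTime

end HawkesScan

open HawkesScan in
theorem theorem4_general {Ω : Type*} [MeasurableSpace Ω] (P : Measure Ω) [IsProbabilityMeasure P]
    {M L : ℕ}
    (I : Matrix (Edge M) (Edge M) ℝ) (E : Fin L → Finset (Edge M))
    (hE : ∀ i, (E i).Nonempty) (hI : ∀ i, (clusterInfo I (E i)).PosDef)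
    (S : ℝ → Edge M → Ω → ℝ) (hS : IsNullScore S I P)
    (w δ : ℝ → ℝ) (m : ℝ → ℕ)
    (hw : ∀ b, 0 < w b) (hδ : ∀ b, 0 < δ b)
    (hwm : Tendsto (fun b => (w b / δ b) / (m b : ℝ)) atTop (𝓝 0))
    (hmpos : ∀ b, 0 < m b)
    (hmf : Tendsto (fun b => (m b : ℝ) / runScale b) atTop (𝓝 0))
    (x : ℝ) (hx : 0 ≤ x) :
    Tendsto
      (fun b : ℝ =>
        |P.real {ω | ((x * runScale b * δ b : ℝ) : EReal) < stopTime S I E (w b) (δ b) b ω}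
          - Real.exp (-∫ ω, blockCount S I E (w b) (δ b) b (m b)
              ⌊x * runScale b / (m b : ℝ)⌋₊ ω ∂P)|)
      atTop (𝓝 0) := by
  have h_bound : Tendsto (fun b => 2 * L * (1 + 2 * L * x) * ((m b : ℝ) / runScale b)
      + 4 * L * x * (w b / δ b / (m b : ℝ))) atTop (𝓝 0) := by
    simpa only [mul_zero, add_zero] using
      (hmf.const_mul (2 * L * (1 + 2 * L * x))).add (hwm.const_mul (4 * L * x))
  refine squeeze_zero' (Eventually.of_forall fun b => abs_nonneg _) ?_ h_bound
  filter_upwards [eventually_gt_atTop 0] with b hb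
  exact hS.abs_measureReal_lt_stopTime_sub_exp_le hE hI (hw b) (hδ b) hb (hmpos b) hx

open HawkesScan in
theorem theorem4 {Ω : Type*} [MeasurableSpace Ω] (P : Measure Ω) [IsProbabilityMeasure P]
    {M L : ℕ}
    -- Fisher information, clusters, and the score process under the null hypothesis
    (I : Matrix (Edge M) (Edge M) ℝ) (E : Fin L → Finset (Edge M))
    (hE : ∀ i, (E i).Nonempty) (hI : ∀ i, (clusterInfo I (E i)).PosDef)
    (S : ℝ → Edge M → Ω → ℝ) (hS : IsNullScore S I P)
    -- window length, update interval and block length, which may vary with the threshold `b`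
    (w δ : ℝ → ℝ) (m : ℝ → ℕ)
    (hδ : ∀ b, 0 < δ b) (hδw : ∀ b, δ b ≤ w b)
    (hwm : Tendsto (fun b => (w b / δ b) / (m b : ℝ)) atTop (𝓝 0))
    (hmpos : ∀ b, 0 < m b)
    (hmf : Tendsto (fun b => (m b : ℝ) / runScale b) atTop (𝓝 0))
    (x : ℝ) (hx : 0 ≤ x) :
    Tendsto
      (fun b : ℝ =>
        |P.real {ω | ((x * runScale b * δ b : ℝ) : EReal) < stopTime S I E (w b) (δ b) b ω}
          - Real.exp (-∫ ω, blockCount S I E (w b) (δ b) b (m b)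
              ⌊x * runScale b / (m b : ℝ)⌋₊ ω ∂P)|)
      atTop (𝓝 0) :=
  theorem4_general P I E hE hI S hS w δ m (fun b => (hδ b).trans_le (hδw b)) hδ hwm hmpos hmf x hx
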